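/- Let $k\ge 2$ and let $n_1,\dots,n_k\ge 2$ be integers with $n_i\mid n_{i-1}$ for $2\le i\le k$ and $n_1>2$. Let $\mathcal A=\{a_1,\dots,a_k\}$ be an alphabet with $k$ letters. For a set $L$ of words over $\mathcal A$, the renewal system $\mathsf X(L)\subseteq\mathcal A^{\mathbb Z}$ is the shift space of all biinfinite sequences each of whose finite factors is a factor of a finite concatenation of words from $L$. Let $\mathsf X_{\mathcal F}$ be the shift of finite type of all sequences in $\mathcal A^{\mathbb Z}$ in which none of the words $a_i^{n_i}$, $1\le i\le k$, occurs, and let $X_d(n_1,\dots,n_k)=\mathsf X(L)$, where $$L=\bigcup_{i=1}^k\Big(\{a_ja_i^l \mid j\ne i,\ 0<l<n_i-1\}\cup\{a_ma_ja_i^l\mid m\neq j,\ j\ne i,\ 0<l<n_i-1\}\Big).$$ If $A$ is the adjacency matrix of a finite directed graph with $p$ vertices, its Bowen--Franks group is $\mathrm{BF}(A)=\mathbb Z^p/\mathbb Z^p(\mathrm{Id}-A)$. A shift of finite type $X$ has signed Bowen--Franks group $\mathrm{BF}_+(X)=-G$ if $X$ is conjugate to the edge shift of a finite directed graph whose adjacency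 matrix $A$ satisfies $\mathrm{BF}(A)\cong G$ and $\det(\mathrm{Id}-A)<0$. Then $m = n_1 n_2\big(k-1-\sum_{i=1}^k \tfrac1{n_i}\big)$ is a non-negative integer, and $$\mathrm{BF}_+(\mathsf X_{\mathcal F})=-\,\mathbb Z/m\mathbb Z\oplus\mathbb Z/n_3\mathbb Z\oplus\cdots\oplus\mathbb Z/n_k\mathbb Z .$$ If moreover $k=2$ or $n_i\ge 3$ for all $i$, then $X_d(n_1,\dots,n_k)=\mathsf X_{\mathcal F}$, and so $$\mathrm{BF}_+(X_d(n_1,\dots,n_k))=-\,\mathbb Z/m\mathbb Z\oplus\mathbb Z/n_3\mathbb Z\oplus\cdots\oplus\mathbb Z/n_k\mathbb Z .$$ -/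

import Mathlib

open SymbolicDynamics.FullShift
open scoped Computability

/-- The word `x_i x_{i+1} ⋯ x_{i+l-1}` of length `l` read off the biinfinite sequence `x`. -/
def block {α : Type*} (x : ℤ → α) (i : ℤ) (l : ℕ) : List α :=
  List.ofFn fun j : Fin l => x (i + (j : ℕ))

theorem block_shift {α : Type*} (g : ℤ) (x : ℤ → α) (i : ℤ) (l : ℕ) :
    block (shift g x) i l = block x (g + i) l := by
  simp [block, add_assoc]

theorem isClosed_block {α : Type*} [TopologicalSpace α] [DiscreteTopology α]
    (S : Set (List α)) (i : ℤ) (l : ℕ) : IsClosed {x : ℤ → α | block x i l ∈ S} := by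
  have hc : Continuous fun (x : ℤ → α) (j : Fin l) => x (i + (j : ℕ)) := by fun_prop
  exact (isClosed_discrete {v : Fin l → α | List.ofFn v ∈ S}).preimage hc

/-- The shift space `X_F` of all biinfinite sequences over `α` which do not contain any of the
forbidden words from `F`. -/
def forbiddenShift {α : Type*} [TopologicalSpace α] [DiscreteTopology α]
    (F : Set (List α)) : Subshift α ℤ where
  carrier := {x | ∀ w ∈ F, ∀ i : ℤ, block x i w.length ≠ w}
  isClosed := by
    simp only [Set.ofPred_forall]
    exact isClosed_iInter fun w => isClosed_iInter fun _ => isClosed_iInter fun i =>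
      isClosed_block {w}ᶜ i w.length
  mapsTo := by
    intro g x hx w hw i
    rw [block_shift]
    exact hx w hw _

/-- The words over `α` that are factors of elements of `L*`, that is, of finite concatenations of
words from `L`. -/
def renewalLanguage {α : Type*} (L : Language α) : Language α :=
  {w | ∃ u ∈ L∗, w <:+: u}

/-- The renewal system `X(L)` generated by the list of words `L`: the shift space of all
biinfinite sequences all of whose factors are factors of elements of `L*`. -/
def renewalSystem {α : Type*} [TopologicalSpace α] [DiscreteTopology α]
    (L : Language α) : Subshift α ℤ where
  carrier := {x | ∀ (i : ℤ) (l : ℕ), block x i l ∈ renewalLanguage L}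
  isClosed := by
    simp only [Set.ofPred_forall]
    exact isClosed_iInter fun i => isClosed_iInter fun l => isClosed_block (renewalLanguage L) i l
  mapsTo := by
    intro g x hx i l
    rw [block_shift]
    exact hx _ _

/-- A conjugacy of shift spaces is a bijective, continuous, shift commuting map. -/
def AreConjugate {α β : Type*} [TopologicalSpace α] [TopologicalSpace β]
    (X : Subshift α ℤ) (Y : Subshift β ℤ) : Prop :=
  ∃ φ : X.carrier → Y.carrier, Function.Bijective φ ∧ Continuous φ ∧
    ∀ x : X.carrier,
      (φ ⟨shift 1 x.1, X.mapsTo 1 x.2⟩ : ℤ → β) = shift 1 (φ x : ℤ → β)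

/-- A directed graph with vertex set `V` and edge set `E`; parallel edges and loops are allowed. -/
structure DirectedGraph (V E : Type*) where
  source : E → V
  range : E → V

/-- The edge shift of a directed graph: all biinfinite paths. -/
def DirectedGraph.edgeShift {V E : Type*} [TopologicalSpace E] [DiscreteTopology E]
    (G : DirectedGraph V E) : Subshift E ℤ where
  carrier := {x | ∀ i : ℤ, G.range (x i) = G.source (x (i + 1))}
  isClosed := by
    simp only [Set.ofPred_forall]
    refine isClosed_iInter fun i => ?_
    have hc : Continuous fun x : ℤ → E => (x i, x (i + 1)) := by fun_prop
    exact (isClosed_discrete {p : E × E | G.range p.1 = G.source p.2}).preimage hc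
  mapsTo := by
    intro g x hx i
    simpa [add_assoc] using hx (g + i)

/-- The adjacency matrix: the `(u, v)` entry is the number of edges from `u` to `v`. -/
def DirectedGraph.adjacencyMatrix {V E : Type*} [Fintype E] [DecidableEq V]
    (G : DirectedGraph V E) : Matrix V V ℤ :=
  fun u v => (Finset.univ.filter fun e : E => G.source e = u ∧ G.range e = v).card

/-- The Bowen--Franks group `ℤⁿ / ℤⁿ (Id - A)` of a square integer matrix `A`, where `ℤⁿ` consists
of row vectors. -/
abbrev BowenFranksGroup {V : Type*} [Fintype V] [DecidableEq V] (A : Matrix V V ℤ) : Type _ :=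
  (V → ℤ) ⧸ LinearMap.range (Matrix.vecMulLinear (1 - A))

/-- The shift space `X` has signed Bowen--Franks group `(s, B)`: it is conjugate to the edge shift
of a finite directed graph with adjacency matrix `A` such that `det (Id - A)` has sign `s` and the
Bowen--Franks group of `A` is isomorphic to `B`. (Every finite directed graph is isomorphic to one
with vertex set `Fin p` and edge set `Fin q`. The sign and the isomorphism class of the group do
not depend on the chosen graph.) -/
def HasSignedBowenFranksGroup {α : Type*} [TopologicalSpace α]
    (X : Subshift α ℤ) (s : SignType) (B : Type*) [AddCommGroup B] : Prop :=
  ∃ (p q : ℕ) (G : DirectedGraph (Fin p) (Fin q)),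
    AreConjugate X G.edgeShift ∧
    SignType.sign (1 - G.adjacencyMatrix).det = s ∧
    Nonempty (BowenFranksGroup G.adjacencyMatrix ≃+ B)

/-- The generating list consisting of the words `a_j a_i^l` with `j ≠ i` and the words
`a_m a_j a_i^l` with `m ≠ j ≠ i`, where `0 < l < n_i - 1`. The letters are `a_i`, `i : Fin k`. -/
def diagonalList {k : ℕ} (n : Fin k → ℕ) : Language (Fin k) :=
  {w | ∃ (i j : Fin k) (l : ℕ), j ≠ i ∧ 0 < l ∧ l < n i - 1 ∧
    (w = j :: List.replicate l i ∨ ∃ m : Fin k, m ≠ j ∧ w = m :: j :: List.replicate l i)}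

/-- The renewal system `X_d(n_1, …, n_k)`. -/
def diagonalRenewalSystem {k : ℕ} (n : Fin k → ℕ) : Subshift (Fin k) ℤ :=
  renewalSystem (diagonalList n)

/-- The shift of finite type over the letters `a_i`, `i : Fin k`, with forbidden words
`a_i ^ (n i)`. -/
def powerForbiddenShift {k : ℕ} (n : Fin k → ℕ) : Subshift (Fin k) ℤ :=
  forbiddenShift (Set.range fun i => List.replicate (n i) i)

/-!
Write `n i = d i + 2`, so that in the shift `X_F` runs of the letter `i` have length at most
`d i + 1`. Reading a sequence of `X_F` together with the length of the current run turns it into a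
path in the finite run-length graph `runGraph d`, with states `⟨i, l⟩` for `l ≤ d i`. Conversely a
path is determined by its letters, because the counter is reset exactly when the letter changes.
So `X_F` is conjugate to the edge shift of this graph
(`areConjugate_powerForbiddenShift_runGraph`).

Let `A` be the adjacency matrix. Eliminating all states but the `⟨i, 0⟩` turns `1 - A` into a
matrix indexed by letters that is diagonal up to rank one, whence
`det (1 - A) = ∏ n i * (1 - k + ∑ 1 / n i)` (`det_one_sub_runMatrix`). This is negative since all
`n i ≥ 2`, one of them is larger and `k ≥ 2`.

In the Bowen--Franks group each vertex is the sum of its successors. Put `G i = [⟨i, d i⟩]`. The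
relations say that `[⟨i, l⟩] = (d i + 1 - l) • G i`, that `n i • G i = S` does not depend on `i`,
and that `∑ G i = (k - 1) • S`; see `isRunFamily_of_eq_sum_runMatrix` and
`eq_sum_runMatrix_of_isRunFamily`. Number the letters from zero. As `n i` divides `n 0`, the
elements `G i - (n 0 / n i) • G 0` are killed by `n i`, and their sum is `c • G 0` with
`c = n 0 * (k - 1 - ∑ 1 / n i)`. This sum relation eliminates the element with index one, and what
remains of its order relation is `n 1 * c • G 0 = 0`, since `n i` divides `n 1` for `i ≥ 2`. The
group is therefore `ZMod (n 1 * c) × ∏ i ≥ 2, ZMod (n i)`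
(`nonempty_bowenFranksGroup_runMatrix_equiv_zmod`).

Finally, a generating word starts with two different letters and ends in a run of length at most
`n i - 2`, so a run in a concatenation has length at most `n i - 1`: the renewal system is contained
in `X_F` (`diagonalRenewalSystem_subset`). Conversely a sequence in `X_F` is cut into generating
words from left to right, leaving over the last letter of each run for the next word
(`exists_mem_diagonalList_block`).
-/

/-! ### The run-length graph -/

/-- The states of the run-length graph: the state `⟨i, l⟩` records that the current run consists of
the letter `i` and has length `l + 1`. Runs of the letter `i` have length at most `d i + 1`. -/
abbrev RunState {ι : Type*} (d : ι → ℕ) : Type _ := Σ i, Fin (d i + 1)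

/-- One letter is read: either the current run grows by one, or a run of another letter starts. -/
def RunStep {ι : Type*} {d : ι → ℕ} (u v : RunState d) : Prop :=
  (u.1 = v.1 ∧ (v.2 : ℕ) = u.2 + 1) ∨ (u.1 ≠ v.1 ∧ (v.2 : ℕ) = 0)

/-- The run-length graph: its edges are the pairs of states related by `RunStep`. -/
def runGraph {ι : Type*} (d : ι → ℕ) :
    DirectedGraph (RunState d) {e : RunState d × RunState d // RunStep e.1 e.2} where
  source e := e.1.1
  range e := e.1.2

open Classical in
/-- The adjacency matrix of the run-length graph, entry by entry. -/
noncomputable def runMatrix {ι : Type*} (d : ι → ℕ) : Matrix (RunState d) (RunState d) ℤ :=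
  fun u v => if RunStep u v then 1 else 0

open Classical in
theorem adjacencyMatrix_runGraph {ι : Type*} (d : ι → ℕ)
    [Fintype {e : RunState d × RunState d // RunStep e.1 e.2}] [DecidableEq (RunState d)] :
    (runGraph d).adjacencyMatrix = runMatrix d := by
  ext u v
  unfold DirectedGraph.adjacencyMatrix runMatrix
  split_ifs with h
  · have : (Finset.univ.filter fun e => (runGraph d).source e = u ∧ (runGraph d).range e = v)
        = {⟨(u, v), h⟩} := by
      ext e
      rw [Finset.mem_filter_univ, Finset.mem_singleton, Subtype.ext_iff, Prod.ext_iff]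
      rfl
    rw [this]; simp
  · rw [Nat.cast_eq_zero, Finset.card_eq_zero, Finset.filter_eq_empty_iff]
    rintro e - ⟨rfl, rfl⟩
    exact h e.2

/-! ### The determinant -/

/-- The part of the adjacency matrix of the run-length graph that prolongs the current run. -/
def growMatrix {ι : Type*} [DecidableEq ι] (d : ι → ℕ) : Matrix (RunState d) (RunState d) ℤ :=
  Matrix.of fun u v => if u.1 = v.1 ∧ (v.2 : ℕ) = u.2 + 1 then 1 else 0

theorem det_one_sub_growMatrix {ι : Type*} [Fintype ι] [DecidableEq ι] (d : ι → ℕ) :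
    (1 - growMatrix d).det = 1 := by
  have hM : (1 - growMatrix d).BlockTriangular fun u => (u.2 : ℕ) := by
    intro u v h
    have h' : (v.2 : ℕ) < u.2 := h
    have h₁ : u ≠ v := by rintro rfl; exact lt_irrefl _ h
    have h₂ : ¬ (v.2 : ℕ) = u.2 + 1 := by omega
    simp [growMatrix, h₁, h₂]
  rw [hM.det]
  refine Finset.prod_eq_one fun a _ => ?_
  suffices h : (1 - growMatrix d).toSquareBlock (fun u => (u.2 : ℕ)) a = 1 by rw [h, Matrix.det_one]
  ext u v
  have huv : ¬ (v.1.2 : ℕ) = u.1.2 + 1 := by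
    have h₁ := u.2
    have h₂ := v.2
    omega
  simp [Matrix.toSquareBlock_def, growMatrix, huv, Matrix.one_apply, Subtype.ext_iff]

theorem sum_growMatrix_smul {ι C : Type*} [Fintype ι] [DecidableEq ι] [AddCommGroup C] {d : ι → ℕ}
    (F : RunState d → C) (i : ι) (l : Fin (d i + 1)) :
    ∑ v, growMatrix d ⟨i, l⟩ v • F v =
      if h : (l : ℕ) < d i then F ⟨i, ⟨l + 1, by omega⟩⟩ else 0 := by
  rw [Fintype.sum_sigma, Finset.sum_eq_single i]
  · split_ifs with h
    · rw [Finset.sum_eq_single ⟨l + 1, by omega⟩]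
      · simp [growMatrix]
      · intro b _ hb
        have : ¬ (b : ℕ) = l + 1 := fun h => hb (Fin.ext h)
        simp [growMatrix, this]
      · simp
    · refine Finset.sum_eq_zero fun b _ => ?_
      have : ¬ (b : ℕ) = l + 1 := by omega
      simp [growMatrix, this]
  · intro j _ hj
    refine Finset.sum_eq_zero fun b _ => ?_
    simp [growMatrix, hj.symm]
  · simp

theorem runMatrix_apply {ι : Type*} [DecidableEq ι] {d : ι → ℕ} (u v : RunState d) :
    runMatrix d u v = growMatrix d u v + if u.1 ≠ v.1 ∧ v.2 = 0 then 1 else 0 := by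
  obtain ⟨i, l⟩ := u
  obtain ⟨j, l'⟩ := v
  by_cases h : i = j
  · subst h
    simp [runMatrix, RunStep, growMatrix]
  · simp [runMatrix, RunStep, growMatrix, h]

theorem sum_runMatrix_smul {ι C : Type*} [Fintype ι] [DecidableEq ι] [AddCommGroup C] {d : ι → ℕ}
    (F : RunState d → C) (i : ι) (l : Fin (d i + 1)) :
    ∑ v, runMatrix d ⟨i, l⟩ v • F v =
      (if h : (l : ℕ) < d i then F ⟨i, ⟨l + 1, by omega⟩⟩ else 0) +
        (∑ j, F ⟨j, 0⟩ - F ⟨i, 0⟩) := by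
  simp_rw [runMatrix_apply, add_smul, Finset.sum_add_distrib, sum_growMatrix_smul]
  congr 1
  rw [Fintype.sum_sigma]
  have : ∀ j, ∑ l' : Fin (d j + 1),
      (if (⟨i, l⟩ : RunState d).1 ≠ (⟨j, l'⟩ : RunState d).1 ∧ (⟨j, l'⟩ : RunState d).2 = 0
        then (1 : ℤ) else 0) • F ⟨j, l'⟩ = if i = j then 0 else F ⟨j, 0⟩ := by
    intro j
    by_cases h : i = j
    · simp [h]
    · rw [Finset.sum_eq_single 0 (fun b _ hb => by simp [hb]) (by simp)]
      simp [h]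
  simp_rw [this]
  rw [eq_sub_iff_add_eq, ← Finset.sum_erase_add _ _ (Finset.mem_univ i), if_pos rfl, add_zero,
    ← Finset.sum_erase_add _ (fun j => F ⟨j, 0⟩) (Finset.mem_univ i)]
  congr 1
  exact Finset.sum_congr rfl fun j hj => if_neg (Finset.ne_of_mem_erase hj).symm

/-- Eliminating all states but the initial states `⟨i, 0⟩` of the runs leaves a matrix indexed by
the letters. -/
theorem det_one_sub_runMatrix_eq_det_letters {ι : Type*} [Fintype ι] [DecidableEq ι] (d : ι → ℕ) :
    (1 - runMatrix d).det =
      (1 - Matrix.of fun i j => if i = j then 0 else (d i + 1 : ℤ)).det := by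
  -- `W ⟨i, l⟩ j` counts the paths from `⟨i, l⟩` to `⟨j, 0⟩` which change the letter only once.
  let W : Matrix (RunState d) ι ℤ :=
    Matrix.of fun u j => if u.1 = j then 0 else (d u.1 : ℤ) + 1 - (u.2 : ℕ)
  let Q : Matrix ι (RunState d) ℤ := Matrix.of fun i v => if i = v.1 ∧ v.2 = 0 then 1 else 0
  have hW : ∀ u v, (W * Q) u v = if v.2 = 0 then W u v.1 else 0 := by
    intro u v
    simp only [Matrix.mul_apply, Q, Matrix.of_apply]
    by_cases h : v.2 = 0 <;> simp [h]
  have hfac : 1 - runMatrix d = (1 - growMatrix d) * (1 - W * Q) := by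
    have hN : growMatrix d * (W * Q) = W * Q -
        Matrix.of fun u v => if u.1 ≠ v.1 ∧ v.2 = 0 then 1 else 0 := by
      ext ⟨i, l⟩ ⟨j, l'⟩
      rw [Matrix.mul_apply]
      refine (sum_growMatrix_smul (fun v => (W * Q) v ⟨j, l'⟩) i l).trans ?_
      simp only [hW, Matrix.sub_apply, Matrix.of_apply, W]
      by_cases hl' : l' = 0 <;> by_cases hij : i = j <;> simp [hl', hij]
      split_ifs with h
      · ring
      · have : (l : ℕ) = d i := by omega
        rw [this]; ring
    rw [sub_mul, one_mul, mul_sub, mul_one, hN]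
    ext u v
    simp only [Matrix.sub_apply, runMatrix_apply, Matrix.of_apply]
    ring
  rw [hfac, Matrix.det_mul, det_one_sub_growMatrix, one_mul, Matrix.det_one_sub_mul_comm]
  congr 2
  ext i j
  rw [Matrix.mul_apply, Finset.sum_eq_single ⟨i, 0⟩]
  · simp [Q, W]
  · rintro ⟨a, b⟩ _ hab
    have : ¬ (i = a ∧ b = 0) := by rintro ⟨rfl, rfl⟩; exact hab rfl
    simp [Q, this]
  · simp

theorem det_one_sub_runMatrix {ι : Type*} [Fintype ι] [DecidableEq ι] (d : ι → ℕ) :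
    ((1 - runMatrix d).det : ℚ) =
      (∏ i, ((d i : ℚ) + 2)) * (1 - Fintype.card ι + ∑ i, 1 / ((d i : ℚ) + 2)) := by
  have hd : ∀ i, (d i : ℚ) + 2 ≠ 0 := fun i => by positivity
  rw [det_one_sub_runMatrix_eq_det_letters, ← eq_intCast (Int.castRingHom ℚ), RingHom.map_det]
  have : (Int.castRingHom ℚ).mapMatrix
      (1 - Matrix.of fun i j => if i = j then 0 else (d i + 1 : ℤ)) =
      Matrix.diagonal (fun i => (d i : ℚ) + 2) *
        (1 + Matrix.replicateCol Unit (fun i => 1 / ((d i : ℚ) + 2) - 1) *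
          Matrix.replicateRow Unit fun _ => (1 : ℚ)) := by
    ext i j
    rw [Matrix.diagonal_mul]
    by_cases h : i = j
    · subst h
      simp [Matrix.mul_apply]
      have := hd i
      field_simp
    · simp [h, Matrix.mul_apply]
      have := hd i
      field_simp
      ring
  rw [this, Matrix.det_mul, Matrix.det_diagonal, Matrix.det_one_add_replicateCol_mul_replicateRow]
  congr 1
  simp [dotProduct, Finset.sum_sub_distrib]
  ring

theorem sign_det_one_sub_runMatrix {ι : Type*} [Fintype ι] [DecidableEq ι] (d : ι → ℕ)
    (h : ∑ i, 1 / ((d i : ℚ) + 2) < Fintype.card ι - 1) :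
    SignType.sign (1 - runMatrix d).det = -1 := by
  rw [sign_eq_neg_one_iff]
  have : ((1 - runMatrix d).det : ℚ) < 0 := by
    rw [det_one_sub_runMatrix]
    exact mul_neg_of_pos_of_neg (Finset.prod_pos fun i _ => by positivity) (by linarith)
  exact_mod_cast this

/-! ### The Bowen--Franks group of the run-length graph -/

section BowenFranks

variable {V C : Type*} [Fintype V] [DecidableEq V] [AddCommGroup C]

/-- The class of the basis vector at the vertex `v` in the Bowen--Franks group. -/
def bowenFranksClass (A : Matrix V V ℤ) (v : V) : BowenFranksGroup A :=
  Submodule.Quotient.mk (Pi.single v 1)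

theorem bowenFranksClass_eq_sum (A : Matrix V V ℤ) (u : V) :
    bowenFranksClass A u = ∑ v, A u v • bowenFranksClass A v := by
  have h : ∑ v, A u v • bowenFranksClass A v =
      Submodule.Quotient.mk (p := LinearMap.range (Matrix.vecMulLinear (1 - A))) (A u) := by
    simp only [bowenFranksClass, ← Submodule.mkQ_apply, ← map_smul, ← map_sum]
    congr 1
    ext v
    simp [Finset.sum_apply, Pi.single_apply]
  rw [h, bowenFranksClass, Submodule.Quotient.eq]
  refine ⟨Pi.single u 1, ?_⟩
  rw [Matrix.vecMulLinear_apply, Matrix.vecMul_sub, Matrix.vecMul_one, Matrix.single_one_vecMul]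
  rfl

/-- The Bowen--Franks group is generated by the classes of the vertices, subject to the relations
saying that the class of a vertex is the sum of the classes of its successors. -/
theorem exists_bowenFranksGroup_lift (A : Matrix V V ℤ) (F : V → C)
    (hF : ∀ u, F u = ∑ v, A u v • F v) :
    ∃ Φ : BowenFranksGroup A →+ C, ∀ v, Φ (bowenFranksClass A v) = F v := by
  let L : (V → ℤ) →ₗ[ℤ] C := Fintype.linearCombination ℤ F
  have hL : LinearMap.range (Matrix.vecMulLinear (1 - A)) ≤ LinearMap.ker L := by
    rw [LinearMap.range_le_ker_iff]
    refine LinearMap.pi_ext' fun u => LinearMap.ext_ring ?_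
    have h : Matrix.vecMul (Pi.single u 1) (1 - A) = Pi.single u 1 - A u := by
      rw [Matrix.vecMul_sub, Matrix.vecMul_one, Matrix.single_one_vecMul]
      rfl
    change L (Matrix.vecMul (Pi.single u 1) (1 - A)) = 0
    rw [h, map_sub, Fintype.linearCombination_apply_single, one_smul,
      Fintype.linearCombination_apply, ← hF u, sub_self]
  refine ⟨(Submodule.liftQ _ L hL).toAddMonoidHom, fun v => ?_⟩
  change Submodule.liftQ _ L hL (Submodule.Quotient.mk _) = _
  rw [Submodule.liftQ_apply]
  simp [L, Fintype.linearCombination_apply_single]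

theorem bowenFranksGroup_hom_ext {A : Matrix V V ℤ} {f g : BowenFranksGroup A →+ C}
    (h : ∀ v, f (bowenFranksClass A v) = g (bowenFranksClass A v)) : f = g := by
  suffices f.toIntLinearMap = g.toIntLinearMap from
    AddMonoidHom.ext fun x => LinearMap.congr_fun this x
  refine Submodule.linearMap_qext _ (LinearMap.pi_ext' fun v => LinearMap.ext_ring ?_)
  exact h v

end BowenFranks

/-- Elements `G i` of an abelian group whose multiples `n i • G i` are all equal to one element,
and whose sum is that element taken `|ι| - 1` times. Such families, with `n i = d i + 2`, are what
homomorphisms out of the Bowen--Franks group of the run-length graph amount to. -/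
def IsRunFamily {ι C : Type*} [Fintype ι] [AddCommGroup C] (n : ι → ℕ) (G : ι → C) : Prop :=
  ∃ S : C, (∀ i, (n i : ℤ) • G i = S) ∧ ∑ i, G i = ((Fintype.card ι : ℤ) - 1) • S

section Run

variable {ι C : Type*} [Fintype ι] [DecidableEq ι] [AddCommGroup C] {d : ι → ℕ}

theorem eq_smul_last_of_eq_sum_runMatrix {F : RunState d → C}
    (hF : ∀ u, F u = ∑ v, runMatrix d u v • F v) (i : ι) (l : Fin (d i + 1)) :
    F ⟨i, l⟩ = ((d i : ℤ) + 1 - (l : ℕ)) • F ⟨i, Fin.last (d i)⟩ := by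
  have hlast : F ⟨i, Fin.last (d i)⟩ = ∑ j, F ⟨j, 0⟩ - F ⟨i, 0⟩ := by
    rw [hF, sum_runMatrix_smul]
    simp
  induction l using Fin.reverseInduction with
  | last => simp
  | cast l ih =>
    rw [hF, sum_runMatrix_smul, ← hlast]
    have h : ((l.castSucc : Fin (d i + 1)) : ℕ) < d i := l.2
    rw [dif_pos h]
    have : (⟨(l.castSucc : Fin (d i + 1)) + 1, by omega⟩ : Fin (d i + 1)) = l.succ := rfl
    rw [this, ih, ← add_one_zsmul]
    congr 1
    simp only [Fin.val_succ, Fin.val_castSucc]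
    push_cast
    ring

theorem isRunFamily_of_eq_sum_runMatrix {F : RunState d → C}
    (hF : ∀ u, F u = ∑ v, runMatrix d u v • F v) :
    IsRunFamily (fun i => d i + 2) fun i => F ⟨i, Fin.last (d i)⟩ := by
  have hlast : ∀ i, F ⟨i, Fin.last (d i)⟩ = ∑ j, F ⟨j, 0⟩ - F ⟨i, 0⟩ := by
    intro i
    rw [hF, sum_runMatrix_smul]
    simp
  refine ⟨∑ j, F ⟨j, 0⟩, fun i => ?_, ?_⟩
  · have h := eq_smul_last_of_eq_sum_runMatrix hF i 0
    have h' := hlast i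
    rw [eq_sub_iff_add_eq, h, ← one_add_zsmul] at h'
    rw [← h']
    congr 1
    push_cast
    simp
    ring
  · simp_rw [hlast, Finset.sum_sub_distrib]
    simp [sub_smul]

theorem eq_sum_runMatrix_of_isRunFamily {G : ι → C} (hG : IsRunFamily (fun i => d i + 2) G)
    (u : RunState d) :
    ((d u.1 : ℤ) + 1 - (u.2 : ℕ)) • G u.1 =
      ∑ v, runMatrix d u v • ((d v.1 : ℤ) + 1 - (v.2 : ℕ)) • G v.1 := by
  obtain ⟨i, l⟩ := u
  obtain ⟨S, hS, hsum⟩ := hG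
  have hz : ∀ j, ((d j : ℤ) + 1) • G j = S - G j := by
    intro j
    rw [← hS j, eq_sub_iff_add_eq, ← add_one_zsmul]
    congr 1
  refine Eq.trans ?_ (sum_runMatrix_smul
    (fun v : RunState d => ((d v.1 : ℤ) + 1 - (v.2 : ℕ)) • G v.1) i l).symm
  have hall : ∑ j, (S - G j) - (S - G i) = G i := by
    rw [Finset.sum_sub_distrib, hsum]
    simp [sub_smul]
  simp only [Fin.val_zero, Nat.cast_zero, sub_zero, hz, hall]
  split_ifs with h
  · rw [← add_one_zsmul]
    congr 1
    push_cast
    ring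
  · have : (l : ℕ) = d i := by omega
    rw [this]
    simp

/-- A group generated by a run family which maps to the run family of the Bowen--Franks group is
isomorphic to the Bowen--Franks group. -/
theorem nonempty_bowenFranksGroup_runMatrix_equiv {g : ι → C}
    (hg : IsRunFamily (fun i => d i + 2) g) (Ψ : C →+ BowenFranksGroup (runMatrix d))
    (hΨ : ∀ i, Ψ (g i) = bowenFranksClass (runMatrix d) ⟨i, Fin.last (d i)⟩)
    (hgen : AddSubgroup.closure (Set.range g) = ⊤) :
    Nonempty (BowenFranksGroup (runMatrix d) ≃+ C) := by
  obtain ⟨Φ, hΦ⟩ := exists_bowenFranksGroup_lift (runMatrix d) _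
    (eq_sum_runMatrix_of_isRunFamily hg)
  refine ⟨Φ.toAddEquiv Ψ (bowenFranksGroup_hom_ext fun ⟨i, l⟩ => ?_)
    (AddMonoidHom.eq_of_eqOn_dense hgen ?_)⟩
  · rw [AddMonoidHom.comp_apply, hΦ, map_zsmul, hΨ, AddMonoidHom.id_apply]
    exact (eq_smul_last_of_eq_sum_runMatrix (bowenFranksClass_eq_sum (runMatrix d)) i l).symm
  · rintro _ ⟨i, rfl⟩
    rw [AddMonoidHom.comp_apply, hΨ, hΦ, AddMonoidHom.id_apply]
    simp

end Run

/-! ### The abelian group presented by a run family -/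

section Target

/-- The homomorphism from `ZMod m` sending `1` to an element killed by `m`. -/
theorem exists_zmod_hom {C : Type*} [AddCommGroup C] {m : ℕ} {x : C} (h : (m : ℤ) • x = 0) :
    ∃ f : ZMod m →+ C, ∀ a : ℤ, f a = a • x :=
  ⟨ZMod.lift m ⟨(zmultiplesHom C) x, by simpa using h⟩, fun a => by simp⟩

variable {k : ℕ}

theorem sum_fin_eq_add_add_sum_subtype {C : Type*} [AddCommGroup C] (hk : 2 ≤ k) (f : Fin k → C) :
    ∑ i, f i = f ⟨0, two_pos.trans_le hk⟩ +
      (f ⟨1, hk⟩ + ∑ i : {i : Fin k // 2 ≤ (i : ℕ)}, f i) := by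
  have h : (Finset.univ : Finset (Fin k)) = insert ⟨0, two_pos.trans_le hk⟩ (insert ⟨1, hk⟩
      (Finset.univ.filter fun i : Fin k => 2 ≤ (i : ℕ))) := by
    ext i
    simp [Fin.ext_iff]
    omega
  rw [h, Finset.sum_insert (by simp), Finset.sum_insert (by simp),
    Finset.sum_subtype (p := fun i : Fin k => 2 ≤ (i : ℕ)) _ (by simp)]

theorem forall_fin_iff_of_two_le (hk : 2 ≤ k) {P : Fin k → Prop} :
    (∀ i, P i) ↔ P ⟨0, two_pos.trans_le hk⟩ ∧ P ⟨1, hk⟩ ∧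
      ∀ i : {i : Fin k // 2 ≤ (i : ℕ)}, P i := by
  refine ⟨fun h => ⟨h _, h _, fun i => h _⟩, fun ⟨h₀, h₁, h₂⟩ i => ?_⟩
  obtain ⟨i, hi⟩ := i
  match i with
  | 0 => exact h₀
  | 1 => exact h₁
  | j + 2 => exact h₂ ⟨⟨j + 2, hi⟩, by simp⟩

variable (n : Fin k → ℕ) (hk : 2 ≤ k)

/-- The integer `n 0 * (k - 1 - ∑ 1 / n i)`, for all `n i` dividing `n 0`; the quotients `n 0 / n i`
are natural-number divisions. -/
def runCoefficient : ℤ :=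
  ((k : ℤ) - 1) * n ⟨0, two_pos.trans_le hk⟩ - ∑ i, ((n ⟨0, two_pos.trans_le hk⟩ / n i : ℕ) : ℤ)

/-- The run family generating `ZMod m × ∏ i ≥ 2, ZMod (n i)` (indices starting at zero). With
`g 0 = (1, 0)`, the generators of index at least two are `(n 0 / n i) • g 0` plus the `i`-th basis
vector, and the one of index one is what the sum relation of `IsRunFamily` makes it. -/
def runGenerator (m : ℕ) (i : Fin k) : ZMod m × ((i : {i : Fin k // 2 ≤ (i : ℕ)}) → ZMod (n i)) :=
  if h : 2 ≤ (i : ℕ) then (((n ⟨0, two_pos.trans_le hk⟩ / n i : ℕ) : ℤ), Pi.single ⟨i, h⟩ 1)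
  else if (i : ℕ) = 0 then (1, 0)
  else ((runCoefficient n hk + (n ⟨0, two_pos.trans_le hk⟩ / n ⟨1, hk⟩ : ℕ) : ℤ), -1)

variable {n hk}

theorem runGenerator_zero (m : ℕ) : runGenerator n hk m ⟨0, two_pos.trans_le hk⟩ = (1, 0) := by
  simp [runGenerator]

theorem runGenerator_one (m : ℕ) : runGenerator n hk m ⟨1, hk⟩ =
    (((runCoefficient n hk + (n ⟨0, two_pos.trans_le hk⟩ / n ⟨1, hk⟩ : ℕ) : ℤ) : ZMod m), -1) := by
  simp [runGenerator]

theorem runGenerator_of_two_le (m : ℕ) (i : {i : Fin k // 2 ≤ (i : ℕ)}) :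
    runGenerator n hk m i =
      ((((n ⟨0, two_pos.trans_le hk⟩ / n i : ℕ) : ℤ) : ZMod m), Pi.single i 1) := by
  simp [runGenerator, i.2]

theorem runCoefficient_eq_sub_sum (h₀ : 0 < n ⟨0, two_pos.trans_le hk⟩) :
    runCoefficient n hk = ((k : ℤ) - 1) * n ⟨0, two_pos.trans_le hk⟩ -
      (1 + ((n ⟨0, two_pos.trans_le hk⟩ / n ⟨1, hk⟩ : ℕ) +
        ∑ i : {i : Fin k // 2 ≤ (i : ℕ)}, ((n ⟨0, two_pos.trans_le hk⟩ / n i : ℕ) : ℤ))) := by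
  rw [runCoefficient, sum_fin_eq_add_add_sum_subtype hk, Nat.div_self h₀, Nat.cast_one]

theorem isRunFamily_runGenerator {m : ℕ} (h₀ : 0 < n ⟨0, two_pos.trans_le hk⟩)
    (hm : (m : ℤ) = n ⟨1, hk⟩ * runCoefficient n hk)
    (hd₀ : ∀ i, n i ∣ n ⟨0, two_pos.trans_le hk⟩)
    (hd₁ : ∀ i : Fin k, 2 ≤ (i : ℕ) → n i ∣ n ⟨1, hk⟩) :
    IsRunFamily n (runGenerator n hk m) := by
  have hq : ∀ i, (n i : ℤ) * (n ⟨0, two_pos.trans_le hk⟩ / n i : ℕ) = n ⟨0, two_pos.trans_le hk⟩ :=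
    fun i => by exact_mod_cast Nat.mul_div_cancel' (hd₀ i)
  refine ⟨(n ⟨0, two_pos.trans_le hk⟩ : ℤ) • (1, 0),
    (forall_fin_iff_of_two_le hk).2 ⟨?_, ?_, fun i => ?_⟩, ?_⟩
  · rw [runGenerator_zero]
  · rw [runGenerator_one, Prod.smul_mk, Prod.smul_mk, Prod.mk.injEq]
    refine ⟨?_, funext fun i => ?_⟩
    · rw [zsmul_eq_mul, ← Int.cast_mul, mul_add, hq, ← hm]
      simp
    · have := (ZMod.natCast_eq_zero_iff _ _).2 (hd₁ i i.2)
      simp [this]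
  · rw [runGenerator_of_two_le, Prod.smul_mk, Prod.smul_mk, Prod.mk.injEq]
    refine ⟨?_, ?_⟩
    · rw [zsmul_eq_mul, ← Int.cast_mul, hq]
      simp
    · rw [← Pi.single_smul]
      simp
  · rw [sum_fin_eq_add_add_sum_subtype hk, runGenerator_zero, runGenerator_one]
    simp_rw [runGenerator_of_two_le]
    refine Prod.ext ?_ (funext fun i => ?_)
    · rw [Prod.smul_fst, Prod.smul_fst]
      simp only [Prod.fst_add, Prod.fst_sum, Fintype.card_fin, zsmul_eq_mul, mul_one]
      rw [runCoefficient_eq_sub_sum h₀]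
      push_cast
      ring
    · simp only [Prod.snd_add, Prod.snd_sum, Prod.smul_snd, Pi.add_apply, Finset.sum_apply]
      simp

theorem closure_range_runGenerator {m : ℕ} :
    AddSubgroup.closure (Set.range (runGenerator n hk m)) = ⊤ := by
  set K := AddSubgroup.closure (Set.range (runGenerator n hk m)) with hK
  have hmem : ∀ i, runGenerator n hk m i ∈ K := fun i => AddSubgroup.subset_closure ⟨i, rfl⟩
  have hl : ∀ a : ZMod m, (a, 0) ∈ K := by
    intro a
    obtain ⟨a, rfl⟩ := ZMod.intCast_surjective a
    have := K.zsmul_mem (hmem ⟨0, two_pos.trans_le hk⟩) a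
    rw [runGenerator_zero] at this
    simpa using this
  have hs : ∀ i : {i : Fin k // 2 ≤ (i : ℕ)}, ∀ b : ZMod (n i), (0, Pi.single i b) ∈ K := by
    intro i b
    obtain ⟨b, rfl⟩ := ZMod.intCast_surjective b
    have := K.zsmul_mem (K.sub_mem (hmem i) (hl (((n ⟨0, two_pos.trans_le hk⟩ / n i : ℕ) : ℤ)))) b
    rw [runGenerator_of_two_le, Prod.mk_sub_mk, sub_self, sub_zero, Prod.smul_mk, smul_zero,
      ← Pi.single_smul] at this
    simpa using this
  rw [eq_top_iff]
  rintro ⟨a, b⟩ -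
  have : (a, b) = (a, 0) + ∑ i, (0, Pi.single i (b i)) := by
    refine Prod.ext ?_ ?_
    · simp [Prod.fst_sum]
    · simp [Prod.snd_sum, Finset.univ_sum_single]
  rw [this]
  exact K.add_mem (hl a) (K.sum_mem fun i _ => hs i _)

/-- `ZMod m × ∏ i ≥ 2, ZMod (n i)` is universal among the groups with a run family. -/
theorem exists_hom_runGenerator {C : Type*} [AddCommGroup C] {m : ℕ} {G : Fin k → C}
    (h₀ : 0 < n ⟨0, two_pos.trans_le hk⟩) (hm : (m : ℤ) = n ⟨1, hk⟩ * runCoefficient n hk)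
    (hd₀ : ∀ i, n i ∣ n ⟨0, two_pos.trans_le hk⟩) (hd₁ : ∀ i : Fin k, 2 ≤ (i : ℕ) → n i ∣ n ⟨1, hk⟩)
    (hG : IsRunFamily n G) :
    ∃ Ψ : ZMod m × ((i : {i : Fin k // 2 ≤ (i : ℕ)}) → ZMod (n i)) →+ C,
      ∀ i, Ψ (runGenerator n hk m i) = G i := by
  obtain ⟨S, hS, hsum⟩ := hG
  have hq : ∀ i, (n i : ℤ) * (n ⟨0, two_pos.trans_le hk⟩ / n i : ℕ) = n ⟨0, two_pos.trans_le hk⟩ :=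
    fun i => by exact_mod_cast Nat.mul_div_cancel' (hd₀ i)
  let H : Fin k → C := fun i =>
    G i - ((n ⟨0, two_pos.trans_le hk⟩ / n i : ℕ) : ℤ) • G ⟨0, two_pos.trans_le hk⟩
  have hH : ∀ i, (n i : ℤ) • H i = 0 := by
    intro i
    rw [smul_sub, smul_smul, hq, hS, hS, sub_self]
  have hH₀ : H ⟨0, two_pos.trans_le hk⟩ = 0 := by
    simp only [H, Nat.div_self h₀, Nat.cast_one, one_smul, sub_self]
  have hHsum : ∑ i, H i = runCoefficient n hk • G ⟨0, two_pos.trans_le hk⟩ := by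
    rw [Finset.sum_sub_distrib, hsum, ← hS ⟨0, two_pos.trans_le hk⟩, smul_smul,
      ← Finset.sum_smul, ← sub_smul, runCoefficient, Fintype.card_fin]
  have hmG : (m : ℤ) • G ⟨0, two_pos.trans_le hk⟩ = 0 := by
    rw [hm, mul_smul, ← hHsum, Finset.smul_sum]
    suffices h : ∀ i, (n ⟨1, hk⟩ : ℤ) • H i = 0 from Finset.sum_eq_zero fun i _ => h i
    refine (forall_fin_iff_of_two_le hk).2 ⟨by rw [hH₀, smul_zero], hH _, fun i => ?_⟩
    obtain ⟨r, hr⟩ := hd₁ i i.2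
    rw [hr, mul_comm, Nat.cast_mul, mul_smul, hH, smul_zero]
  obtain ⟨f, hf⟩ := exists_zmod_hom hmG
  choose e he using fun i : {i : Fin k // 2 ≤ (i : ℕ)} => exists_zmod_hom (hH i)
  refine ⟨f.coprod (∑ i, (e i).comp (Pi.evalAddMonoidHom _ i)),
    (forall_fin_iff_of_two_le hk).2 ⟨?_, ?_, fun i => ?_⟩⟩
  · rw [runGenerator_zero, AddMonoidHom.coprod_apply, map_zero, add_zero]
    simpa using hf 1
  · have he' : ∀ i, e i (-1) = - H i := fun i => by simpa using he i (-1)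
    rw [runGenerator_one, AddMonoidHom.coprod_apply, hf, add_smul, ← hHsum,
      sum_fin_eq_add_add_sum_subtype hk, hH₀]
    simp only [AddMonoidHom.finsetSum_apply, AddMonoidHom.comp_apply, Pi.evalAddMonoidHom_apply,
      Pi.neg_apply, Pi.one_apply, he', Finset.sum_neg_distrib]
    simp only [H]
    abel
  · have he' : e i 1 = H i := by simpa using he i 1
    rw [runGenerator_of_two_le, AddMonoidHom.coprod_apply, hf, AddMonoidHom.finsetSum_apply,
      Finset.sum_eq_single i]
    · simp [he', H]
    · intro j _ hj
      simp [Pi.single_eq_of_ne hj]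
    · simp

end Target

/-- The Bowen--Franks group of the run-length graph. -/
theorem nonempty_bowenFranksGroup_runMatrix_equiv_zmod {k : ℕ} (hk : 2 ≤ k) {d : Fin k → ℕ} {m : ℕ}
    (hm : (m : ℤ) = (d ⟨1, hk⟩ + 2 : ℕ) * runCoefficient (fun i => d i + 2) hk)
    (hd₀ : ∀ i, d i + 2 ∣ d ⟨0, two_pos.trans_le hk⟩ + 2)
    (hd₁ : ∀ i : Fin k, 2 ≤ (i : ℕ) → d i + 2 ∣ d ⟨1, hk⟩ + 2) :
    Nonempty (BowenFranksGroup (runMatrix d) ≃+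
      ZMod m × ((i : {i : Fin k // 2 ≤ (i : ℕ)}) → ZMod (d i + 2))) := by
  obtain ⟨Ψ, hΨ⟩ := exists_hom_runGenerator (n := fun i => d i + 2) (hk := hk) (by simp) hm hd₀ hd₁
    (isRunFamily_of_eq_sum_runMatrix (bowenFranksClass_eq_sum (runMatrix d)))
  exact nonempty_bowenFranksGroup_runMatrix_equiv
    (isRunFamily_runGenerator (n := fun i => d i + 2) (by simp) hm hd₀ hd₁) Ψ hΨ
    closure_range_runGenerator

/-! ### Conjugacy of the power-forbidden shift with the run-length edge shift -/

theorem subshift_ext {α : Type*} [TopologicalSpace α] {X Y : Subshift α ℤ}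
    (h : X.carrier = Y.carrier) : X = Y := by
  cases X; cases Y; cases h; rfl

theorem AreConjugate.trans {α β γ : Type*} [TopologicalSpace α] [TopologicalSpace β]
    [TopologicalSpace γ] {X : Subshift α ℤ} {Y : Subshift β ℤ} {Z : Subshift γ ℤ}
    (h₁ : AreConjugate X Y) (h₂ : AreConjugate Y Z) : AreConjugate X Z := by
  obtain ⟨φ, hφ, hφc, hφs⟩ := h₁
  obtain ⟨ψ, hψ, hψc, hψs⟩ := h₂
  refine ⟨ψ ∘ φ, hψ.comp hφ, hψc.comp hφc, fun x => ?_⟩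
  have : φ ⟨shift 1 x.1, X.mapsTo 1 x.2⟩ = ⟨shift 1 (φ x).1, Y.mapsTo 1 (φ x).2⟩ :=
    Subtype.ext (hφs x)
  rw [Function.comp_apply, Function.comp_apply, this, hψs]

/-- The inverse of a conjugacy out of a compact shift space is a conjugacy. -/
theorem AreConjugate.symm {α β : Type*} [TopologicalSpace α] [TopologicalSpace β]
    [CompactSpace α] [T2Space β] {X : Subshift α ℤ} {Y : Subshift β ℤ}
    (h : AreConjugate X Y) : AreConjugate Y X := by
  obtain ⟨φ, hφ, hφc, hφs⟩ := h
  have : CompactSpace X.carrier := isCompact_iff_compactSpace.1 X.isClosed.isCompact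
  let e := Equiv.ofBijective φ hφ
  have hsymm : Continuous e.symm := Continuous.continuous_symm_of_equiv_compact_to_t2 (f := e) hφc
  refine ⟨e.symm, e.symm.bijective, hsymm, fun y => ?_⟩
  have : e ⟨shift 1 (e.symm y).1, X.mapsTo 1 (e.symm y).2⟩ = ⟨shift 1 y.1, Y.mapsTo 1 y.2⟩ := by
    refine Subtype.ext ((hφs _).trans ?_)
    change shift 1 (e (e.symm y)).1 = _
    rw [e.apply_symm_apply]
  rw [← this, e.symm_apply_apply]

theorem block_eq_replicate_iff {α : Type*} {x : ℤ → α} {p : ℤ} {l : ℕ} {a : α} :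
    block x p l = List.replicate l a ↔ ∀ j < l, x (p + (j : ℕ)) = a := by
  rw [List.eq_replicate_iff]
  simp [block, List.mem_ofFn, Fin.forall_iff]

theorem mem_powerForbiddenShift_iff {k : ℕ} {n : Fin k → ℕ} {x : ℤ → Fin k} :
    x ∈ (powerForbiddenShift n).carrier ↔
      ∀ (i : Fin k) (p : ℤ), ∃ j < n i, x (p + (j : ℕ)) ≠ i := by
  simp only [powerForbiddenShift, forbiddenShift, Set.mem_ofPred_eq, Set.forall_mem_range,
    List.length_replicate, ne_eq, block_eq_replicate_iff, not_forall, exists_prop]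

section RunGraph

variable {k : ℕ} {d : Fin k → ℕ}

/-- The sequence of letters read along a sequence of edges of the run-length graph. -/
def runLetters (y : ℤ → {e : RunState d × RunState d // RunStep e.1 e.2}) (t : ℤ) : Fin k :=
  (y t).1.1.1

theorem mem_runGraph_edgeShift_iff {y : ℤ → {e : RunState d × RunState d // RunStep e.1 e.2}} :
    y ∈ (runGraph d).edgeShift.carrier ↔ ∀ t, (y t).1.2 = (y (t + 1)).1.1 :=
  Iff.rfl

theorem runStep_of_mem {y : ℤ → {e : RunState d × RunState d // RunStep e.1 e.2}}
    (hy : y ∈ (runGraph d).edgeShift.carrier) (t : ℤ) : RunStep (y t).1.1 (y (t + 1)).1.1 := by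
  rw [← mem_runGraph_edgeShift_iff.1 hy t]
  exact (y t).2

theorem runLetters_mem {y : ℤ → {e : RunState d × RunState d // RunStep e.1 e.2}}
    (hy : y ∈ (runGraph d).edgeShift.carrier) :
    runLetters y ∈ (powerForbiddenShift fun i => d i + 2).carrier := by
  rw [mem_powerForbiddenShift_iff]
  intro i p
  by_contra! h
  -- The run-length counter would grow along the whole run of `d i + 2` letters `i`.
  have hgrow : ∀ j < d i + 2, j ≤ ((y (p + (j : ℕ))).1.1.2 : ℕ) := by
    intro j
    induction j with
    | zero => simp
    | succ j ih =>
      intro hj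
      have h₁ := h j (by omega)
      have h₂ := h (j + 1) hj
      have hih := ih (by omega)
      rw [Nat.cast_succ, ← add_assoc] at h₂ ⊢
      rcases runStep_of_mem hy (p + (j : ℕ)) with hs | hs
      · omega
      · exact absurd (h₁.trans h₂.symm) hs.1
  have h₁ := hgrow (d i + 1) (by omega)
  have h₂ := h (d i + 1) (by omega)
  have h₃ := (y (p + (d i + 1 : ℕ))).1.1.2.2
  have h₄ : d (y (p + (d i + 1 : ℕ))).1.1.1 = d i := congrArg d h₂
  omega

theorem val_eq_of_runLetters_eq {y z : ℤ → {e : RunState d × RunState d // RunStep e.1 e.2}}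
    (hy : y ∈ (runGraph d).edgeShift.carrier) (hz : z ∈ (runGraph d).edgeShift.carrier)
    (h : runLetters y = runLetters z) (l : ℕ) :
    ∀ t, ((y t).1.1.2 : ℕ) = l → ((z t).1.1.2 : ℕ) = l := by
  induction l with
  | zero =>
    intro t ht
    obtain ⟨t, rfl⟩ : ∃ s, t = s + 1 := ⟨t - 1, by ring⟩
    have h₀ : (y t).1.1.1 = (z t).1.1.1 := congrFun h t
    have h₁ : (y (t + 1)).1.1.1 = (z (t + 1)).1.1.1 := congrFun h (t + 1)
    rcases runStep_of_mem hy t with hs | hs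
    · omega
    · rcases runStep_of_mem hz t with hs' | hs'
      · exact absurd (h₀.trans (hs'.1.trans h₁.symm)) hs.1
      · exact hs'.2
  | succ l ih =>
    intro t ht
    obtain ⟨t, rfl⟩ : ∃ s, t = s + 1 := ⟨t - 1, by ring⟩
    have h₀ : (y t).1.1.1 = (z t).1.1.1 := congrFun h t
    have h₁ : (y (t + 1)).1.1.1 = (z (t + 1)).1.1.1 := congrFun h (t + 1)
    rcases runStep_of_mem hy t with hs | hs
    · rcases runStep_of_mem hz t with hs' | hs'
      · have := ih t (by omega)
        omega
      · exact absurd (h₀.symm.trans (hs.1.trans h₁)) hs'.1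
    · omega

theorem runLetters_injOn : Set.InjOn (runLetters (d := d)) (runGraph d).edgeShift.carrier := by
  intro y hy z hz h
  have hst : ∀ t, (y t).1.1 = (z t).1.1 := by
    intro t
    have h₁ := val_eq_of_runLetters_eq hy hz h _ t rfl
    have h₂ : (y t).1.1.1 = (z t).1.1.1 := congrFun h t
    generalize (y t).1.1 = u at *
    generalize (z t).1.1 = v at *
    obtain ⟨i, a⟩ := u
    obtain ⟨j, b⟩ := v
    obtain rfl : i = j := h₂
    exact congrArg (Sigma.mk i) (Fin.ext h₁.symm)
  funext t
  refine Subtype.ext (Prod.ext (hst t) ?_)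
  rw [mem_runGraph_edgeShift_iff.1 hy, mem_runGraph_edgeShift_iff.1 hz, hst]

/-- The length, minus one, of the run of equal letters ending at a position: the least `l` such
that the letter `l + 1` places to the left is a different one. -/
theorem exists_run_length {x : ℤ → Fin k}
    (hx : x ∈ (powerForbiddenShift fun i => d i + 2).carrier) (t : ℤ) :
    ∃ l : ℕ, l < d (x t) + 1 ∧ x (t - l - 1) ≠ x t ∧ ∀ j < l, x (t - (j : ℕ) - 1) = x t := by
  classical
  have hex : ∃ l : ℕ, l < d (x t) + 1 ∧ x (t - l - 1) ≠ x t := by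
    obtain ⟨j, hj, hne⟩ := mem_powerForbiddenShift_iff.1 hx (x t) (t - (d (x t) + 1 : ℕ))
    have hj' : j ≠ d (x t) + 1 := by
      rintro rfl
      exact hne (by rw [sub_add_cancel])
    refine ⟨d (x t) - j, by omega, ?_⟩
    convert hne using 2
    have : j ≤ d (x t) := by omega
    push_cast [this]
    ring
  refine ⟨Nat.find hex, (Nat.find_spec hex).1, (Nat.find_spec hex).2, fun j hj => ?_⟩
  by_contra h
  exact Nat.find_min hex hj ⟨hj.trans (Nat.find_spec hex).1, h⟩

theorem exists_runLetters_eq {x : ℤ → Fin k}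
    (hx : x ∈ (powerForbiddenShift fun i => d i + 2).carrier) :
    ∃ y ∈ (runGraph d).edgeShift.carrier, runLetters y = x := by
  choose r hr hne heq using exists_run_length hx
  let s : ℤ → RunState d := fun t => ⟨x t, ⟨r t, hr t⟩⟩
  have hs : ∀ t, RunStep (s t) (s (t + 1)) := by
    intro t
    have h₁ := hne t
    have h₂ := heq t
    have h₃ := hne (t + 1)
    have h₄ := heq (t + 1)
    by_cases h : x t = x (t + 1)
    · refine Or.inl ⟨h, ?_⟩
      change r (t + 1) = r t + 1
      have h₀ : r (t + 1) ≠ 0 := by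
        intro h₀
        rw [h₀] at h₃
        exact h₃ (by simpa using h)
      obtain ⟨q, hq⟩ := Nat.exists_eq_succ_of_ne_zero h₀
      rw [hq] at h₃ h₄ ⊢
      have e : ∀ j : ℕ, t + 1 - ((j + 1 : ℕ) : ℤ) - 1 = t - j - 1 := fun j => by push_cast; ring
      have h₅ : ∀ j < q, x (t - (j : ℕ) - 1) = x t := fun j hj => by
        rw [← e, h₄ (j + 1) (by omega), h]
      rw [Nat.succ_eq_add_one, e, ← h] at h₃
      have : ¬ r t < q := fun hlt => h₁ (h₅ _ hlt)
      have : ¬ q < r t := fun hlt => h₃ (h₂ _ hlt)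
      omega
    · refine Or.inr ⟨h, ?_⟩
      change r (t + 1) = 0
      by_contra h₀
      exact h (by simpa using h₄ 0 (by omega))
  exact ⟨fun t => ⟨(s t, s (t + 1)), hs t⟩, fun t => rfl, rfl⟩

theorem areConjugate_powerForbiddenShift_runGraph (d : Fin k → ℕ) :
    AreConjugate (powerForbiddenShift fun i => d i + 2) (runGraph d).edgeShift := by
  refine AreConjugate.symm ⟨fun y => ⟨runLetters y.1, runLetters_mem y.2⟩, ⟨?_, ?_⟩, ?_, ?_⟩
  · intro y z h
    exact Subtype.ext (runLetters_injOn y.2 z.2 (congrArg Subtype.val h))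
  · rintro ⟨x, hx⟩
    obtain ⟨y, hy, rfl⟩ := exists_runLetters_eq hx
    exact ⟨⟨y, hy⟩, rfl⟩
  · refine Continuous.subtype_mk (continuous_pi fun t => ?_) _
    exact (continuous_of_discreteTopology (f := fun e :
      {e : RunState d × RunState d // RunStep e.1 e.2} => e.1.1.1)).comp
      ((continuous_apply t).comp continuous_subtype_val)
  · intro y
    rfl

end RunGraph

/-! ### Relabelling a directed graph -/

theorem AreConjugate.edgeShift_relabel {V E V' E' : Type*} [TopologicalSpace E] [DiscreteTopology E]
    [TopologicalSpace E'] [DiscreteTopology E'] (G : DirectedGraph V E) (a : V ≃ V') (b : E ≃ E') :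
    AreConjugate G.edgeShift
      (⟨fun e => a (G.source (b.symm e)), fun e => a (G.range (b.symm e))⟩ :
        DirectedGraph V' E').edgeShift := by
  refine ⟨fun x => ⟨fun t => b (x.1 t), fun t => ?_⟩, ⟨?_, ?_⟩, ?_, fun x => rfl⟩
  · have := x.2 t
    simp [this]
  · intro x y h
    refine Subtype.ext (funext fun t => b.injective ?_)
    exact congrFun (congrArg Subtype.val h) t
  · rintro ⟨y, hy⟩
    refine ⟨⟨fun t => b.symm (y t), fun t => ?_⟩, Subtype.ext (funext fun t => by simp)⟩
    exact a.injective (hy t)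
  · refine Continuous.subtype_mk (continuous_pi fun t => ?_) _
    exact continuous_of_discreteTopology.comp ((continuous_apply t).comp continuous_subtype_val)

theorem adjacencyMatrix_relabel {V E V' E' : Type*} [Fintype E] [DecidableEq V] [Fintype E']
    [DecidableEq V'] (G : DirectedGraph V E) (a : V ≃ V') (b : E ≃ E') :
    (⟨fun e => a (G.source (b.symm e)), fun e => a (G.range (b.symm e))⟩ :
      DirectedGraph V' E').adjacencyMatrix = Matrix.reindex a a G.adjacencyMatrix := by
  ext u v
  simp only [DirectedGraph.adjacencyMatrix, Matrix.reindex_apply, Matrix.submatrix_apply]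
  rw [Nat.cast_inj]
  refine Finset.card_equiv b.symm fun e => ?_
  simp [Equiv.eq_symm_apply]

theorem nonempty_bowenFranksGroup_reindex_equiv {V V' : Type*} [Fintype V] [DecidableEq V]
    [Fintype V'] [DecidableEq V'] (A : Matrix V V ℤ) (a : V ≃ V') :
    Nonempty (BowenFranksGroup (Matrix.reindex a a A) ≃+ BowenFranksGroup A) := by
  have h : ∀ u, bowenFranksClass A (a.symm u) =
      ∑ v, Matrix.reindex a a A u v • bowenFranksClass A (a.symm v) := by
    intro u
    rw [bowenFranksClass_eq_sum, ← a.symm.sum_comp]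
    rfl
  have h' : ∀ u, bowenFranksClass (Matrix.reindex a a A) (a u) =
      ∑ v, A u v • bowenFranksClass (Matrix.reindex a a A) (a v) := by
    intro u
    rw [bowenFranksClass_eq_sum, ← a.sum_comp]
    simp
  obtain ⟨f, hf⟩ := exists_bowenFranksGroup_lift _ _ h
  obtain ⟨g, hg⟩ := exists_bowenFranksGroup_lift _ _ h'
  exact ⟨f.toAddEquiv g
    (bowenFranksGroup_hom_ext fun v => by
      rw [AddMonoidHom.comp_apply, hf, hg, a.apply_symm_apply, AddMonoidHom.id_apply])
    (bowenFranksGroup_hom_ext fun v => by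
      rw [AddMonoidHom.comp_apply, hg, hf, a.symm_apply_apply, AddMonoidHom.id_apply])⟩

/-- A signed Bowen--Franks group may be computed from a graph with arbitrary finite types of
vertices and edges. -/
theorem hasSignedBowenFranksGroup_of_areConjugate {α V E : Type*} [TopologicalSpace α] [Fintype V]
    [DecidableEq V] [Fintype E] [TopologicalSpace E] [DiscreteTopology E] {X : Subshift α ℤ}
    {s : SignType} {B : Type*} [AddCommGroup B] (G : DirectedGraph V E)
    (hX : AreConjugate X G.edgeShift) (hs : SignType.sign (1 - G.adjacencyMatrix).det = s)
    (hB : Nonempty (BowenFranksGroup G.adjacencyMatrix ≃+ B)) :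
    HasSignedBowenFranksGroup X s B := by
  let a := Fintype.equivFin V
  let b := Fintype.equivFin E
  refine ⟨_, _, ⟨fun e => a (G.source (b.symm e)), fun e => a (G.range (b.symm e))⟩,
    hX.trans (AreConjugate.edgeShift_relabel G a b), ?_, ?_⟩
  · rw [adjacencyMatrix_relabel, ← hs]
    have : 1 - Matrix.reindex a a G.adjacencyMatrix =
        Matrix.reindex a a (1 - G.adjacencyMatrix) := by
      simp [Matrix.submatrix_sub]
    rw [this, Matrix.det_reindex_self]
  · rw [adjacencyMatrix_relabel]
    obtain ⟨f⟩ := nonempty_bowenFranksGroup_reindex_equiv G.adjacencyMatrix a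
    obtain ⟨g⟩ := hB
    exact ⟨f.trans g⟩

/-! ### Runs in the words of the generated language -/

theorem length_le_one_of_replicate_prefix {α : Type*} {i a b : α} {c : ℕ} {t : List α}
    (hab : a ≠ b) (h : List.replicate c i <+: a :: b :: t) : c ≤ 1 := by
  match c with
  | 0 => simp
  | 1 => simp
  | c + 2 =>
    simp only [List.replicate_succ, List.cons_prefix_cons] at h
    exact absurd (h.1.symm.trans h.2.1) hab

section RunBounds

variable {k : ℕ} {n : Fin k → ℕ}

/-- Every word of the generating list starts with two different letters. -/
theorem exists_cons_cons_of_mem_diagonalList {w : List (Fin k)} (hw : w ∈ diagonalList n) :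
    ∃ a b t, a ≠ b ∧ w = a :: b :: t := by
  obtain ⟨i, j, l, hji, hl, -, rfl | ⟨m, hmj, rfl⟩⟩ := hw
  · obtain ⟨l, rfl⟩ := Nat.exists_eq_succ_of_ne_zero hl.ne'
    exact ⟨j, i, _, hji, rfl⟩
  · exact ⟨m, j, _, hmj, rfl⟩

/-- The last run of a word of the generating list is at least two short of its forbidden length,
which leaves room for the one letter by which the next word may prolong it. -/
theorem le_of_replicate_suffix_of_mem_diagonalList {w : List (Fin k)} (hw : w ∈ diagonalList n)
    {i : Fin k} {c : ℕ} (h : List.replicate c i <:+ w) : c ≤ n i - 2 := by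
  obtain ⟨i', j, l, hji, hl, hln, hw⟩ := hw
  rcases Nat.eq_zero_or_pos c with rfl | hc
  · simp
  have hrep : List.replicate c i <:+ List.replicate l i' → c ≤ n i - 2 := by
    intro h
    have hi : i = i' :=
      List.eq_of_mem_replicate (h.subset (List.mem_replicate.2 ⟨hc.ne', rfl⟩))
    have := h.length_le
    simp only [List.length_replicate] at this
    subst hi
    omega
  have htwo : ∀ (a b : Fin k) (t : List (Fin k)), a ≠ b → List.replicate c i ≠ a :: b :: t := by
    intro a b t hab he
    have hpre : List.replicate c i <+: a :: b :: t := by rw [he]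
    have h₁ := length_le_one_of_replicate_prefix hab hpre
    have h₂ := congrArg List.length he
    simp at h₂
    omega
  obtain ⟨l, rfl⟩ := Nat.exists_eq_succ_of_ne_zero hl.ne'
  have hshort : List.replicate c i <:+ j :: List.replicate (l + 1) i' → c ≤ n i - 2 := by
    intro h
    rcases List.suffix_cons_iff.1 h with h | h
    · exact absurd h (htwo _ _ _ hji)
    · exact hrep h
  rcases hw with rfl | ⟨m, hmj, rfl⟩
  · exact hshort h
  · rcases List.suffix_cons_iff.1 h with h | h
    · exact absurd h (htwo _ _ _ hmj)
    · exact hshort h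

theorem le_of_replicate_infix_of_mem_diagonalList {w : List (Fin k)} (hw : w ∈ diagonalList n)
    (hn : ∀ i, 2 ≤ n i) {i : Fin k} {c : ℕ} (h : List.replicate c i <:+: w) : c ≤ n i - 1 := by
  have hi := hn i
  obtain ⟨i', j, l, hji, hl, hln, hw⟩ := hw
  obtain ⟨l, rfl⟩ := Nat.exists_eq_succ_of_ne_zero hl.ne'
  have hshort : List.replicate c i <:+: j :: List.replicate (l + 1) i' → c ≤ n i - 1 := by
    intro h
    rcases List.infix_cons_iff.1 h with h | h
    · have := length_le_one_of_replicate_prefix hji h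
      omega
    · rcases Nat.eq_zero_or_pos c with rfl | hc
      · simp
      have hi : i = i' :=
        List.eq_of_mem_replicate (h.subset (List.mem_replicate.2 ⟨hc.ne', rfl⟩))
      have := h.length_le
      simp only [List.length_replicate] at this
      subst hi
      omega
  rcases hw with rfl | ⟨m, hmj, rfl⟩
  · exact hshort h
  · rcases List.infix_cons_iff.1 h with h | h
    · have := length_le_one_of_replicate_prefix hmj h
      omega
    · exact hshort h

theorem replicate_bounds_of_flatten {L : List (List (Fin k))} (hL : ∀ w ∈ L, w ∈ diagonalList n)
    (hn : ∀ i, 2 ≤ n i) (i : Fin k) (c : ℕ) :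
    (List.replicate c i <+: L.flatten → c ≤ 1) ∧
      (List.replicate c i <:+: L.flatten → c ≤ n i - 1) := by
  induction L generalizing c with
  | nil =>
    simp only [List.flatten_nil, List.prefix_nil, List.infix_nil, List.replicate_eq_nil_iff]
    exact ⟨fun h => by omega, fun h => by omega⟩
  | cons w L ih =>
    have hw := hL w (by simp)
    have ih := ih fun w hw => hL w (by simp [hw])
    have hi := hn i
    rw [List.flatten_cons]
    refine ⟨fun h => ?_, fun h => ?_⟩
    · obtain ⟨a, b, t, hab, rfl⟩ := exists_cons_cons_of_mem_diagonalList hw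
      exact length_le_one_of_replicate_prefix hab h
    · rcases List.infix_append_iff.1 h with h | h | ⟨u, v, huv, hu, hv⟩
      · exact le_of_replicate_infix_of_mem_diagonalList hw hn h
      · exact (ih c).2 h
      · obtain ⟨hc, hu', hv'⟩ := List.append_eq_replicate_iff.1 huv.symm
        rw [hu'] at hu
        rw [hv'] at hv
        have h₁ := le_of_replicate_suffix_of_mem_diagonalList hw hu
        have h₂ := (ih _).1 hv
        omega

theorem diagonalRenewalSystem_subset (hn : ∀ i, 2 ≤ n i) :
    (diagonalRenewalSystem n).carrier ⊆ (powerForbiddenShift n).carrier := by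
  rintro x hx _ ⟨i, rfl⟩ p hp
  obtain ⟨u, hu, hinf⟩ := hx p (List.replicate (n i) i).length
  rw [hp] at hinf
  obtain ⟨L, rfl, hL⟩ := Language.mem_kstar.1 hu
  have := (replicate_bounds_of_flatten hL hn i (n i)).2 hinf
  have := hn i
  omega

/-! ### Cutting sequences without forbidden powers into generating words -/

theorem block_add {α : Type*} (x : ℤ → α) (p : ℤ) (a b : ℕ) :
    block x p (a + b) = block x p a ++ block x (p + a) b := by
  simp [block, List.ofFn_add, add_assoc]

theorem block_succ {α : Type*} (x : ℤ → α) (p : ℤ) (a : ℕ) :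
    block x p (a + 1) = x p :: block x (p + 1) a := by
  rw [add_comm, block_add]
  simp [block]

theorem block_infix_block {α : Type*} (x : ℤ → α) {p q : ℤ} {a b : ℕ} (hpq : p ≤ q)
    (h : q + a ≤ p + b) : block x q a <:+: block x p b := by
  obtain ⟨c, rfl⟩ := Int.exists_add_of_le hpq
  obtain ⟨e, rfl⟩ : ∃ e, b = c + (a + e) := ⟨b - c - a, by omega⟩
  rw [block_add, block_add]
  exact ⟨block x p c, block x (p + c + a) e, by simp⟩

/-- The run starting at `p` in a sequence without forbidden powers: its length `c` is positive and
less than `n (x p)`, and the next letter differs from its last one. -/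
theorem exists_run_of_mem {x : ℤ → Fin k} (hx : x ∈ (powerForbiddenShift n).carrier) (p : ℤ) :
    ∃ c : ℕ, c + 1 < n (x p) ∧ block x p (c + 1) = List.replicate (c + 1) (x p) ∧
      x (p + c) ≠ x (p + c + 1) := by
  classical
  have hex := mem_powerForbiddenShift_iff.1 hx (x p) p
  have hmin : ∀ j < Nat.find hex, x (p + (j : ℕ)) = x p := by
    intro j hj
    by_contra h
    exact Nat.find_min hex hj ⟨hj.trans (Nat.find_spec hex).1, h⟩
  have hspec := Nat.find_spec hex
  have hpos : Nat.find hex ≠ 0 := by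
    intro h
    rw [h] at hspec
    simp at hspec
  obtain ⟨c, hc⟩ := Nat.exists_eq_succ_of_ne_zero hpos
  rw [hc] at hspec hmin
  refine ⟨c, hspec.1, block_eq_replicate_iff.2 hmin, ?_⟩
  rw [hmin c (by simp), add_assoc]
  exact_mod_cast hspec.2.symm

/-- If a generating word may start at `p`, in that the letters at `p` and `p + 1` differ, then one
can be read from `p` on such that again a generating word may start right after it. -/
theorem exists_mem_diagonalList_block (hk : 2 ≤ k) (hn₁ : 2 < n ⟨0, two_pos.trans_le hk⟩)
    (h : k = 2 ∨ ∀ i, 3 ≤ n i) {x : ℤ → Fin k} (hx : x ∈ (powerForbiddenShift n).carrier) {p : ℤ}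
    (hp : x p ≠ x (p + 1)) :
    ∃ l : ℕ, 0 < l ∧ block x p l ∈ diagonalList n ∧ x (p + l) ≠ x (p + l + 1) := by
  -- The last letter of every run is left over as the first letter of the next word.
  obtain ⟨c, hc, hrun, hne⟩ := exists_run_of_mem hx (p + 1)
  rcases Nat.eq_zero_or_pos c with rfl | hc₀
  swap
  · refine ⟨c + 1, by omega, ⟨x (p + 1), x p, c, hp, hc₀, by omega, Or.inl ?_⟩, ?_⟩
    · rw [block_succ, List.cons.injEq]
      refine ⟨rfl, block_eq_replicate_iff.2 fun j hj => ?_⟩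
      exact block_eq_replicate_iff.1 hrun j (by omega)
    · convert hne using 2 <;> push_cast <;> ring
  have hp₁ : x (p + 1) ≠ x (p + 2) := by
    convert hne using 2 <;> push_cast <;> ring
  obtain ⟨e, he, hrun', hne'⟩ := exists_run_of_mem hx (p + 2)
  rcases Nat.eq_zero_or_pos e with rfl | he₀
  swap
  · refine ⟨e + 1 + 1, by omega,
      ⟨x (p + 2), x (p + 1), e, hp₁, he₀, by omega, Or.inr ⟨x p, hp, ?_⟩⟩, ?_⟩
    · rw [block_succ, block_succ, List.cons.injEq, List.cons.injEq]
      refine ⟨rfl, rfl, block_eq_replicate_iff.2 fun j hj => ?_⟩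
      rw [add_assoc p 1 1, one_add_one_eq_two]
      exact block_eq_replicate_iff.1 hrun' j (by omega)
    · convert hne' using 2 <;> push_cast <;> ring
  have hp₂ : x (p + 2) ≠ x (p + 3) := by
    convert hne' using 2 <;> push_cast <;> ring
  by_cases h₃ : 3 ≤ n (x (p + 1))
  · refine ⟨2, by omega, ⟨x (p + 1), x p, 1, hp, one_pos, by omega, Or.inl ?_⟩, ?_⟩
    · simp [block]
    · convert hp₂ using 2 <;> push_cast <;> ring
  -- Here there are two letters, which alternate, and only the first one may be repeated.
  obtain rfl : k = 2 := h.resolve_right fun h => h₃ (h _)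
  have hval : ∀ {a b : Fin 2}, a ≠ b → (a : ℕ) + b = 1 := by decide
  have h₀ : ∀ a : Fin 2, n a < 3 → (a : ℕ) = 1 := by
    intro a ha
    by_contra h
    have : a = ⟨0, two_pos.trans_le hk⟩ := Fin.ext (by simp; omega)
    rw [this] at ha
    omega
  have ha := h₀ _ (not_le.1 h₃)
  have hb := hval hp₁
  have hc := hval hp₂
  have h₄ : x (p + 3) = x (p + 1) := Fin.ext (by omega)
  have hbig : 3 ≤ n (x (p + 2)) := by
    by_contra h
    have := h₀ _ (not_le.1 h)
    omega
  refine ⟨3, by omega, ⟨x (p + 2), x (p + 1), 1, hp₁, one_pos, by omega,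
    Or.inr ⟨x p, hp, ?_⟩⟩, ?_⟩
  · simp [block]
  · obtain ⟨e, he, -, hne⟩ := exists_run_of_mem hx (p + 3)
    rw [h₄] at he
    obtain rfl : e = 0 := by omega
    convert hne using 2 <;> push_cast <;> ring

theorem exists_mem_kstar_block {L : Language (Fin k)} {x : ℤ → Fin k} {P : ℤ → Prop}
    (h : ∀ p, P p → ∃ l : ℕ, 0 < l ∧ block x p l ∈ L ∧ P (p + l)) {p : ℤ} (hp : P p) (N : ℕ) :
    ∃ l : ℕ, N ≤ l ∧ block x p l ∈ L∗ ∧ P (p + l) := by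
  induction N with
  | zero => exact ⟨0, le_rfl, by simpa [block] using Language.nil_mem_kstar L, by simpa using hp⟩
  | succ N ih =>
    obtain ⟨l, hl, hmem, hP⟩ := ih
    obtain ⟨l', hl', hmem', hP'⟩ := h _ hP
    refine ⟨l + l', by omega, ?_, by simpa [add_assoc] using hP'⟩
    rw [block_add]
    obtain ⟨S, hS, hSL⟩ := Language.mem_kstar.1 hmem
    refine Language.mem_kstar.2 ⟨S ++ [block x (p + l) l'], by simp [hS], ?_⟩
    intro y hy
    rcases List.mem_append.1 hy with hy | hy
    · exact hSL y hy
    · rw [List.mem_singleton.1 hy]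
      exact hmem'

theorem diagonalRenewalSystem_eq_powerForbiddenShift (hk : 2 ≤ k) (hn : ∀ i, 2 ≤ n i)
    (hn₁ : 2 < n ⟨0, two_pos.trans_le hk⟩) (h : k = 2 ∨ ∀ i, 3 ≤ n i) :
    diagonalRenewalSystem n = powerForbiddenShift n := by
  refine subshift_ext (Set.Subset.antisymm (diagonalRenewalSystem_subset hn) ?_)
  intro x hx p l
  -- Runs are bounded, so a generating word may start at some position to the left of `p`.
  obtain ⟨q, hqp, hq⟩ : ∃ q ≤ p, x q ≠ x (q + 1) := by
    by_contra! hcon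
    obtain ⟨j, hj, hne⟩ := mem_powerForbiddenShift_iff.1 hx (x p) (p - n (x p))
    have hconst : ∀ a : ℕ, x (p - a) = x p := by
      intro a
      induction a with
      | zero => simp
      | succ a ih =>
        rw [← ih, hcon _ (by omega)]
        congr 1
        push_cast
        ring
    refine hne ((congrArg x ?_).trans (hconst (n (x p) - j)))
    rw [Nat.cast_sub hj.le, ← sub_add]
  obtain ⟨b, hb, hmem, -⟩ := exists_mem_kstar_block (L := diagonalList n)
    (P := fun p => x p ≠ x (p + 1)) (fun p hp => exists_mem_diagonalList_block hk hn₁ h hx hp) hq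
    ((p - q).toNat + l)
  exact ⟨_, hmem, block_infix_block x hqp (by omega)⟩

end RunBounds

/-! ### The signed Bowen--Franks group -/

theorem dvd_of_le_of_forall_succ_dvd {k : ℕ} {n : Fin k → ℕ}
    (hdvd : ∀ (i : ℕ) (hi : i + 1 < k), n ⟨i + 1, hi⟩ ∣ n ⟨i, i.lt_of_succ_lt hi⟩) {i j : ℕ}
    (hij : i ≤ j) :
    ∀ hj : j < k, n ⟨j, hj⟩ ∣ n ⟨i, hij.trans_lt hj⟩ := by
  induction j, hij using Nat.le_induction with
  | base => exact fun _ => dvd_rfl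
  | succ j _ ih => exact fun hj => (hdvd j hj).trans (ih (by omega))

theorem runCoefficient_cast {k : ℕ} (hk : 2 ≤ k) {n : Fin k → ℕ} (hn : ∀ i, 2 ≤ n i)
    (hd : ∀ i, n i ∣ n ⟨0, two_pos.trans_le hk⟩) :
    (runCoefficient n hk : ℚ) = n ⟨0, two_pos.trans_le hk⟩ * (k - 1 - ∑ i, 1 / (n i : ℚ)) := by
  have h : ∀ i, ((n ⟨0, two_pos.trans_le hk⟩ / n i : ℕ) : ℚ) =
      n ⟨0, two_pos.trans_le hk⟩ * (1 / (n i : ℚ)) := by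
    intro i
    have := hn i
    rw [Nat.cast_div (hd i) (by positivity), mul_one_div]
  rw [runCoefficient, Int.cast_sub, Int.cast_mul, Int.cast_sum]
  simp_rw [Int.cast_natCast, h]
  rw [← Finset.mul_sum]
  push_cast
  ring

theorem sum_one_div_lt {k : ℕ} (hk : 2 ≤ k) {n : Fin k → ℕ} (hn : ∀ i, 2 ≤ n i)
    (hn₁ : 2 < n ⟨0, two_pos.trans_le hk⟩) : ∑ i, 1 / (n i : ℚ) < k - 1 := by
  have hle : ∀ i, 1 / (n i : ℚ) ≤ 1 / 2 := fun i =>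
    one_div_le_one_div_of_le two_pos (by exact_mod_cast hn i)
  have hlt : ∑ i, 1 / (n i : ℚ) < ∑ _i : Fin k, (1 / 2 : ℚ) :=
    Finset.sum_lt_sum (fun i _ => hle i) ⟨⟨0, two_pos.trans_le hk⟩, Finset.mem_univ _,
      one_div_lt_one_div_of_lt two_pos (by exact_mod_cast hn₁)⟩
  have hk' : (2 : ℚ) ≤ k := by exact_mod_cast hk
  rw [Finset.sum_const, Finset.card_univ, Fintype.card_fin, nsmul_eq_mul] at hlt
  linarith

theorem hasSignedBowenFranksGroup_powerForbiddenShift {k : ℕ} (hk : 2 ≤ k) (n : Fin k → ℕ)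
    (hn : ∀ i, 2 ≤ n i)
    (hdvd : ∀ (i : ℕ) (hi : i + 1 < k), n ⟨i + 1, hi⟩ ∣ n ⟨i, i.lt_of_succ_lt hi⟩)
    (hn₁ : 2 < n ⟨0, two_pos.trans_le hk⟩) {m : ℕ}
    (hm : (m : ℤ) = n ⟨1, hk⟩ * runCoefficient n hk) :
    HasSignedBowenFranksGroup (powerForbiddenShift n) (-1)
      (ZMod m × ((i : {i : Fin k // 2 ≤ (i : ℕ)}) → ZMod (n i))) := by
  classical
  obtain ⟨d, rfl⟩ : ∃ d : Fin k → ℕ, n = fun i => d i + 2 :=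
    ⟨fun i => n i - 2, funext fun i => (Nat.sub_add_cancel (hn i)).symm⟩
  refine hasSignedBowenFranksGroup_of_areConjugate (runGraph d)
    (areConjugate_powerForbiddenShift_runGraph d) ?_ ?_
  · rw [adjacencyMatrix_runGraph]
    refine sign_det_one_sub_runMatrix d ?_
    simpa using sum_one_div_lt hk hn hn₁
  · rw [adjacencyMatrix_runGraph]
    exact nonempty_bowenFranksGroup_runMatrix_equiv_zmod hk hm
      (fun i => dvd_of_le_of_forall_succ_dvd (n := fun i => d i + 2) hdvd (Nat.zero_le _) i.2)
      (fun i hi => dvd_of_le_of_forall_succ_dvd (n := fun i => d i + 2) hdvd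
        (one_le_two.trans hi) i.2)

theorem mainTheorem4 (k : ℕ) (hk : 2 ≤ k) (n : Fin k → ℕ) (hn : ∀ i, 2 ≤ n i)
    (hdvd : ∀ (i : ℕ) (hi : i + 1 < k), n ⟨i + 1, hi⟩ ∣ n ⟨i, by omega⟩)
    (hn₁ : 2 < n ⟨0, by omega⟩) :
    ∃ m : ℕ,
      (m : ℚ) = n ⟨0, by omega⟩ * n ⟨1, by omega⟩ * (k - 1 - ∑ i, 1 / (n i : ℚ)) ∧
      HasSignedBowenFranksGroup (powerForbiddenShift n) (-1)
        (ZMod m × ((i : {i : Fin k // 2 ≤ (i : ℕ)}) → ZMod (n i))) ∧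
      ((k = 2 ∨ ∀ i, 3 ≤ n i) →
        diagonalRenewalSystem n = powerForbiddenShift n ∧
        HasSignedBowenFranksGroup (diagonalRenewalSystem n) (-1)
          (ZMod m × ((i : {i : Fin k // 2 ≤ (i : ℕ)}) → ZMod (n i)))) := by
  have hd₀ : ∀ i, n i ∣ n ⟨0, by omega⟩ := fun i =>
    dvd_of_le_of_forall_succ_dvd hdvd (Nat.zero_le _) i.2
  have hcast := runCoefficient_cast hk hn hd₀
  have hnonneg : 0 ≤ runCoefficient n hk := by
    have : (0 : ℚ) ≤ runCoefficient n hk := by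
      rw [hcast]
      exact mul_nonneg (Nat.cast_nonneg _) (sub_nonneg.2 (sum_one_div_lt hk hn hn₁).le)
    exact_mod_cast this
  obtain ⟨c, hc⟩ := Int.eq_ofNat_of_zero_le hnonneg
  have hm : ((n ⟨1, by omega⟩ * c : ℕ) : ℤ) = n ⟨1, by omega⟩ * runCoefficient n hk := by
    rw [hc, Nat.cast_mul]
  have hBF := hasSignedBowenFranksGroup_powerForbiddenShift hk n hn hdvd hn₁ hm
  refine ⟨n ⟨1, by omega⟩ * c, ?_, hBF, fun h => ?_⟩
  · rw [hc, Int.cast_natCast] at hcast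
    rw [Nat.cast_mul, hcast]
    ring
  · have heq := diagonalRenewalSystem_eq_powerForbiddenShift hk hn hn₁ h
    exact ⟨heq, heq ▸ hBF⟩
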